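/- Fix a countable set of atoms. \emph{Structures} are generated by $R ::= a \mid \mathsf 1 \mid \bot \mid [R \mathbin{\wp} R] \mid (R\otimes R)\mid \overline R$ ($a$ an atom) and are taken modulo the smallest congruence $\approx$ containing associativity and commutativity of $\wp$ (par) and of $\otimes$ (copar, or times) and the equations $\overline{[R \mathbin{\wp} T]}\approx(\overline R\otimes\overline T)$, $\overline{(R\otimes T)}\approx[\overline R \mathbin{\wp} \overline T]$, $\overline{\overline R}\approx R$, $\overline\bot\approx\mathsf 1$, $\overline{\mathsf 1}\approx\bot$. Below, "atom" includes negated atoms and the units $\mathsf 1,\bot$; $\mathrm{at}\,R$ is the set of atoms occurring in the negation normal form of $R$; $S\{\ \}$ ranges over contexts whose hole is not in the scope of a negation. Consider the following inference rules (from premise to conclusion): - $\mathsf{ai}{\downarrow}$: from $S\{\mathsf 1\}$ infer $S[a \mathbin{\wp} \overline a]$ ($a$ an atom); - $\mathsf{s}$: from $S([U \mathbin{\wp} R]\otimes T)$ infer $S[U \mathbin{\wp} (R\otimes T)]$; - $\mathsf{u}_1{\downarrow}$: from $S\{R\}$ infer $S[R \mathbin{\wp} \bot]$; $\mathsf{u}_1{\uparrow}$: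 from $S(R\otimes\mathsf 1)$ infer $S\{R\}$; - $\mathsf{u}_2{\downarrow}$: from $S\{R\}$ infer $S(R\otimes\mathsf 1)$; $\mathsf{u}_2{\uparrow}$: from $S[R \mathbin{\wp} \bot]$ infer $S\{R\}$. An instance of $\mathsf s$ is \emph{deep} (d) if $R$ is a par structure or an atom different from $\mathsf 1$, \emph{lazy} (l) if $U$ is a copar ($\otimes$) structure or an atom different from $\bot$, and \emph{interaction} (i) if $\mathrm{at}\,\overline R\cap\mathrm{at}\,U\neq\emptyset$. Let $\mathsf{MLS}=\{\mathsf{ai}{\downarrow},\mathsf s,\mathsf u_1{\downarrow},\mathsf u_1{\uparrow},\mathsf u_2{\downarrow},\mathsf u_2{\uparrow}\}$ and $\mathsf{MLSu}=\{\mathsf{ai}{\downarrow},\mathsf s,\mathsf u_1{\downarrow},\mathsf u_2{\downarrow}\}$; for each nonempty combination of the letters d, l, i, the system $\mathsf{MLS}$ with that combination as suffix ($\mathsf{MLSl}$, $\mathsf{MLSd}$, $\mathsf{MLSi}$, $\mathsf{MLSdl}$, $\mathsf{MLSli}$, $\mathsf{MLSdi}$, $\mathsf{MLSdli}$) is obtained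 from $\mathsf{MLSu}$ by restricting $\mathsf s$ to the instances that satisfy all the named conditions. A structure is \emph{provable} in a system if it is derived from $\mathsf 1$ by a finite (possibly empty) chain of instances of its rules; two systems are \emph{equivalent} if they prove the same structures. Then: 1. the systems $\mathsf{MLS}$, $\mathsf{MLSu}$, $\mathsf{MLSl}$, $\mathsf{MLSd}$, $\mathsf{MLSdl}$ and $\mathsf{MLSdli}$ are pairwise equivalent; 2. the systems $\mathsf{MLSu}$, $\mathsf{MLSl}$, $\mathsf{MLSd}$, $\mathsf{MLSi}$, $\mathsf{MLSdl}$, $\mathsf{MLSli}$, $\mathsf{MLSdi}$ and $\mathsf{MLSdli}$ are pairwise equivalent; 3. each of the eight systems in 2 is complete for multiplicative linear logic: a structure $R$ is provable in it if and only if the formula obtained from $R$ by pushing negations to the atoms is provable in the cut-free one-sided sequent calculus $\mathsf{MLL}$, whose rules on multiset sequents are the following (with $\overline A$ the De Morgan dual of $A$): $\vdash A,\overline A$; $\vdash\mathsf 1$; from $\vdash\Phi$ infer $\vdash\bot,\Phi$; from $\vdash A,B,\Phi$ infer $\vdash A \mathbin{\wp} B,\Phi$; from $\vdash A,\Phi$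 and $\vdash B,\Psi$ infer $\vdash A\otimes B,\Phi,\Psi$. -/

import Mathlib

namespace DeepMLL

/-! ### Structures -/

/-- Structures of multiplicative linear logic over a set `α` of (non-unit) atoms. -/
inductive Structure (α : Type*) where
  | atom (a : α) : Structure α
  | one : Structure α
  | bot : Structure α
  | par (R T : Structure α) : Structure α
  | copar (R T : Structure α) : Structure α
  | neg (R : Structure α) : Structure α

/-- Atoms in the wide sense: atoms, negated atoms and the two units. -/
inductive Literal (α : Type*) where
  | pos (a : α) : Literal α
  | neg (a : α) : Literal α
  | one : Literal α
  | bot : Literal α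

/-- The complementary atom. -/
def Literal.dual {α : Type*} : Literal α → Literal α
  | .pos a => .neg a
  | .neg a => .pos a
  | .one => .bot
  | .bot => .one

def Literal.toStructure {α : Type*} : Literal α → Structure α
  | .pos a => .atom a
  | .neg a => .neg (.atom a)
  | .one => .one
  | .bot => .bot

namespace Structure

variable {α : Type*}

/-- The smallest congruence on structures containing associativity and commutativity of par and
copar and the equations for negation. -/
inductive Equiv : Structure α → Structure α → Prop
  | refl (R : Structure α) : Equiv R R
  | symm {R T : Structure α} : Equiv R T → Equiv T R
  | trans {R T U : Structure α} : Equiv R T → Equiv T U → Equiv R U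
  | par_congr {R R' T T' : Structure α} :
      Equiv R R' → Equiv T T' → Equiv (par R T) (par R' T')
  | copar_congr {R R' T T' : Structure α} :
      Equiv R R' → Equiv T T' → Equiv (copar R T) (copar R' T')
  | neg_congr {R R' : Structure α} : Equiv R R' → Equiv (neg R) (neg R')
  | par_assoc (R T U : Structure α) : Equiv (par (par R T) U) (par R (par T U))
  | copar_assoc (R T U : Structure α) : Equiv (copar (copar R T) U) (copar R (copar T U))
  | par_comm (R T : Structure α) : Equiv (par R T) (par T R)
  | copar_comm (R T : Structure α) : Equiv (copar R T) (copar T R)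
  | neg_par (R T : Structure α) : Equiv (neg (par R T)) (copar (neg R) (neg T))
  | neg_copar (R T : Structure α) : Equiv (neg (copar R T)) (par (neg R) (neg T))
  | neg_neg (R : Structure α) : Equiv (neg (neg R)) R
  | neg_bot : Equiv (neg bot) one
  | neg_one : Equiv (neg one) bot

/-- The set `at R` of the atoms in `R`; atoms in the scope of a negation count with the
complementary sign, so that this is the set of the atoms in the negation normal form of `R`. -/
def atomSet : Structure α → Set (Literal α)
  | atom a => {Literal.pos a}
  | one => {Literal.one}
  | bot => {Literal.bot}
  | par R T => atomSet R ∪ atomSet T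
  | copar R T => atomSet R ∪ atomSet T
  | neg R => Literal.dual '' atomSet R

def IsPar (R : Structure α) : Prop := ∃ A B : Structure α, Equiv R (par A B)

def IsCopar (R : Structure α) : Prop := ∃ A B : Structure α, Equiv R (copar A B)

/-- `R` is an atom (possibly negated, possibly a unit) other than `l`. -/
def IsAtomOtherThan (l : Literal α) (R : Structure α) : Prop :=
  ∃ k : Literal α, k ≠ l ∧ Equiv R k.toStructure

end Structure

/-- Structure contexts: structures with one hole, not in the scope of a negation. -/
inductive Context (α : Type*) where
  | hole : Context α
  | parLeft (S : Context α) (T : Structure α) : Context α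
  | parRight (T : Structure α) (S : Context α) : Context α
  | coparLeft (S : Context α) (T : Structure α) : Context α
  | coparRight (T : Structure α) (S : Context α) : Context α

/-- `S.fill R` is `S{R}`. -/
def Context.fill {α : Type*} : Context α → Structure α → Structure α
  | .hole, R => R
  | .parLeft S T, R => .par (S.fill R) T
  | .parRight T S, R => .par T (S.fill R)
  | .coparLeft S T, R => .copar (S.fill R) T
  | .coparRight T S, R => .copar T (S.fill R)

/-! ### Rules, systems and proofs -/

/-- Names of the inference rules. `switch d l i` is the switch rule, restricted to deep instances
if `d`, to lazy instances if `l`, and to interaction instances if `i`. -/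
inductive Rule where
  | aiDown : Rule
  | aiUp : Rule
  | u1Down : Rule
  | u1Up : Rule
  | u2Down : Rule
  | u2Up : Rule
  | switch (deep lazy interaction : Bool) : Rule

namespace Rule

abbrev s : Rule := switch false false false
abbrev ls : Rule := switch false true false
abbrev ds : Rule := switch true false false
abbrev is : Rule := switch false false true
abbrev dls : Rule := switch true true false
abbrev lis : Rule := switch false true true
abbrev dis : Rule := switch true false true
abbrev dlis : Rule := switch true true true

end Rule

/-- The side condition of interaction switch: `R` and `U` contain complementary atoms. -/
def Interacts {α : Type*} (R U : Structure α) : Prop :=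
  (R.neg.atomSet ∩ U.atomSet).Nonempty

/-- The side condition of lazy switch. -/
def LazyCond {α : Type*} (U : Structure α) : Prop :=
  U.IsCopar ∨ U.IsAtomOtherThan Literal.bot

/-- The side condition of deep switch. -/
def DeepCond {α : Type*} (R : Structure α) : Prop :=
  R.IsPar ∨ R.IsAtomOtherThan Literal.one

open Structure in
/-- `RuleInstance ρ R T`: the rule `ρ` has, inside every context, an instance with redex `R` (in
the conclusion) and contractum `T` (in the premise). -/
inductive RuleInstance {α : Type*} : Rule → Structure α → Structure α → Prop
  | aiDown (a : Literal α) :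
      RuleInstance Rule.aiDown (par a.toStructure (neg a.toStructure)) one
  | aiUp (a : Literal α) (R : Structure α) :
      RuleInstance Rule.aiUp R (par R (copar a.toStructure (neg a.toStructure)))
  | u1Down (R : Structure α) : RuleInstance Rule.u1Down (par R bot) R
  | u1Up (R : Structure α) : RuleInstance Rule.u1Up R (copar R one)
  | u2Down (R : Structure α) : RuleInstance Rule.u2Down (copar R one) R
  | u2Up (R : Structure α) : RuleInstance Rule.u2Up R (par R bot)
  | switch (d l i : Bool) (U R T : Structure α)
      (hd : d = true → DeepCond R) (hl : l = true → LazyCond U)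
      (hi : i = true → Interacts R U) :
      RuleInstance (Rule.switch d l i) (par U (copar R T)) (copar (par U R) T)

/-- A system is a set of inference rules. -/
abbrev System : Type := Set Rule

/-- `P` (conclusion) is rewritten to `Q` (premise) by an instance of a rule of `𝒮`; structures are
taken modulo `Structure.Equiv`. -/
def Step {α : Type*} (𝒮 : System) (P Q : Structure α) : Prop :=
  ∃ ρ ∈ 𝒮, ∃ (S : Context α) (R T : Structure α),
    RuleInstance ρ R T ∧ Structure.Equiv P (S.fill R) ∧ Structure.Equiv Q (S.fill T)

/-- `Derivation 𝒮 T R`: there is a derivation in `𝒮` with premise `T` and conclusion `R`. -/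
inductive Derivation {α : Type*} (𝒮 : System) (T : Structure α) : Structure α → Prop
  | nil {R : Structure α} : Structure.Equiv R T → Derivation 𝒮 T R
  | cons {R Q : Structure α} : Step 𝒮 R Q → Derivation 𝒮 T Q → Derivation 𝒮 T R

/-- `R` has a proof in `𝒮`. -/
def Provable {α : Type*} (𝒮 : System) (R : Structure α) : Prop :=
  Derivation 𝒮 Structure.one R

def SMLS : System :=
  {Rule.aiDown, Rule.s, Rule.aiUp, Rule.u1Down, Rule.u1Up, Rule.u2Down, Rule.u2Up}

def MLS : System := SMLS \ {Rule.aiUp}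

def MLSu : System := SMLS \ {Rule.u1Up, Rule.u2Up, Rule.aiUp}

/-- `MLSu` with the switch rule replaced by `σ`. -/
def MLSWith (σ : Rule) : System := (MLSu \ {Rule.s}) ∪ {σ}

def MLSl : System := MLSWith Rule.ls
def MLSd : System := MLSWith Rule.ds
def MLSi : System := MLSWith Rule.is
def MLSdl : System := MLSWith Rule.dls
def MLSli : System := MLSWith Rule.lis
def MLSdi : System := MLSWith Rule.dis
def MLSdli : System := MLSWith Rule.dlis

/-- Two systems are equivalent if they prove the same structures. -/
def SystemEquivalent (α : Type*) (𝒮 𝒯 : System) : Prop :=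
  ∀ R : Structure α, Provable 𝒮 R ↔ Provable 𝒯 R

/-! ### The sequent calculus for multiplicative linear logic -/

/-- Formulae of multiplicative linear logic, in negation normal form. -/
inductive Formula (α : Type*) where
  | lit (l : Literal α) : Formula α
  | par (A B : Formula α) : Formula α
  | tensor (A B : Formula α) : Formula α

/-- Linear negation of formulae, by De Morgan duality. -/
def Formula.dual {α : Type*} : Formula α → Formula α
  | .lit l => .lit l.dual
  | .par A B => .tensor A.dual B.dual
  | .tensor A B => .par A.dual B.dual

/-- Cut-free provability of (one-sided, multiset) sequents in `MLL`. -/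
inductive MLL {α : Type*} : Multiset (Formula α) → Prop
  | id (A : Formula α) : MLL (A ::ₘ A.dual ::ₘ 0)
  | tensor {A B : Formula α} {Φ Ψ : Multiset (Formula α)} :
      MLL (A ::ₘ Φ) → MLL (B ::ₘ Ψ) → MLL (Formula.tensor A B ::ₘ (Φ + Ψ))
  | par {A B : Formula α} {Φ : Multiset (Formula α)} :
      MLL (A ::ₘ B ::ₘ Φ) → MLL (Formula.par A B ::ₘ Φ)
  | bot {Φ : Multiset (Formula α)} : MLL Φ → MLL (Formula.lit Literal.bot ::ₘ Φ)
  | one : MLL (Formula.lit Literal.one ::ₘ 0)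

/-- The translation of a structure into a formula. -/
def Structure.toFormula {α : Type*} : Structure α → Formula α
  | .atom a => .lit (.pos a)
  | .one => .lit .one
  | .bot => .lit .bot
  | .par R T => .par R.toFormula T.toFormula
  | .copar R T => .tensor R.toFormula T.toFormula
  | .neg R => R.toFormula.dual

/-- `𝒮` is (sound and) complete for multiplicative linear logic: a structure has a proof in `𝒮`
if and only if its translation into a formula has a proof in `MLL`. -/
def CompleteForMLL (α : Type*) (𝒮 : System) : Prop :=
  ∀ R : Structure α, Provable 𝒮 R ↔ MLL {R.toFormula}

end DeepMLL

namespace DeepMLL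

open scoped Pointwise

/-! ### Formulae as structures -/

/-! A deep, lazy, interaction instance of switch is an instance of every other form of switch, and
all rules, the up rules included, are sound for MLL. So two facts suffice: whatever is derivable is
provable in MLL, and MLL-provable formulae are derivable in `MLSdli`.

Soundness uses the phase space of multisets of formulae, with cut-free provability as the pole.
Every rule is an inclusion of facts, so `0` lies in the fact of each provable structure, and Okada's
lemma (`singleton_mem_perp_sem`) turns this into an MLL proof. The same model yields cut
admissibility (`MLL.sound`), hence the inversions of par and `⊥`.

Completeness is by progress (`MLL.hasStep`) and termination (`weight_step`): each provable formula
other than `1` has an `MLSdli` step to a provable one. The step is found by induction on the size of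
sequents. Pars are decomposed. In a flat sequent ending with a tensor rule, rules are permuted until
the left component `A` of the split is not a tensor (`Splits.exists_ne_tensor`); then `A` is `1`,
and `u2Down` applies, or it meets the deep condition. A step of the left premise `A, Φ` that lies
within `A` or within `Φ` is kept. If it joins `A` to some `V` in `Φ`, then `V` is switched next to
`A` instead: the two interact, and flatness makes the switch lazy. -/

@[simp] theorem Literal.dual_dual {α : Type*} (l : Literal α) : l.dual.dual = l := by
  cases l <;> rfl

def Formula.toStructure {α : Type*} : Formula α → Structure α
  | .lit l => l.toStructure
  | .par A B => .par A.toStructure B.toStructure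
  | .tensor A B => .copar A.toStructure B.toStructure

theorem Literal.equiv_neg {α : Type*} (l : Literal α) :
    Structure.Equiv l.toStructure.neg l.dual.toStructure := by
  cases l with
  | pos a => exact .refl _
  | neg a => exact .neg_neg _
  | one => exact .neg_one
  | bot => exact .neg_bot

theorem Formula.equiv_neg {α : Type*} (A : Formula α) :
    Structure.Equiv A.toStructure.neg A.dual.toStructure := by
  induction A with
  | lit l => exact l.equiv_neg
  | par A B hA hB => exact (Structure.Equiv.neg_par _ _).trans (.copar_congr hA hB)
  | tensor A B hA hB => exact (Structure.Equiv.neg_copar _ _).trans (.par_congr hA hB)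

theorem Structure.equiv_toFormula {α : Type*} (R : Structure α) :
    Structure.Equiv R R.toFormula.toStructure := by
  induction R with
  | atom a => exact .refl _
  | one => exact .refl _
  | bot => exact .refl _
  | par R T hR hT => exact .par_congr hR hT
  | copar R T hR hT => exact .copar_congr hR hT
  | neg R hR => exact (Structure.Equiv.neg_congr hR).trans (Formula.equiv_neg _)

/-! ### Phase semantics -/

section Phase

variable {α : Type*}

/-- The orthogonal of a set of sequents, with respect to provability in `MLL`. -/
def perp (X : Set (Multiset (Formula α))) : Set (Multiset (Formula α)) :=
  {y | ∀ x ∈ X, MLL (x + y)}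

theorem perp_anti {X Y : Set (Multiset (Formula α))} (h : X ⊆ Y) : perp Y ⊆ perp X :=
  fun _ hy x hx => hy x (h hx)

theorem subset_perp_perp (X : Set (Multiset (Formula α))) : X ⊆ perp (perp X) := by
  intro x hx y hy
  rw [add_comm]
  exact hy x hx

@[simp] theorem perp_perp_perp (X : Set (Multiset (Formula α))) :
    perp (perp (perp X)) = perp X :=
  (perp_anti (subset_perp_perp X)).antisymm (subset_perp_perp _)

theorem perp_perp_subset {X Y : Set (Multiset (Formula α))} (h : X ⊆ perp Y) :
    perp (perp X) ⊆ perp Y := by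
  rw [← perp_perp_perp Y]
  exact perp_anti (perp_anti h)

theorem mem_perp_add {X Y : Set (Multiset (Formula α))} {z : Multiset (Formula α)} :
    z ∈ perp (X + Y) ↔ ∀ x ∈ X, ∀ y ∈ Y, MLL (x + y + z) := by
  constructor
  · intro h x hx y hy
    exact h _ (Set.add_mem_add hx hy)
  · rintro h _ ⟨x, hx, y, hy, rfl⟩
    exact h x hx y hy

@[simp] theorem perp_add_left (X Y : Set (Multiset (Formula α))) :
    perp (perp (perp X) + Y) = perp (X + Y) := by
  apply (perp_anti (Set.add_subset_add_right (subset_perp_perp X))).antisymm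
  intro z hz
  rw [mem_perp_add] at hz ⊢
  intro w hw y hy
  have : y + z ∈ perp X := fun x hx => by rw [← add_assoc]; exact hz x hx y hy
  have h := hw _ this
  rwa [show w + y + z = y + z + w by abel]

@[simp] theorem perp_add_right (X Y : Set (Multiset (Formula α))) :
    perp (X + perp (perp Y)) = perp (X + Y) := by
  rw [add_comm, perp_add_left, add_comm]

/-- The interpretation of structures as facts of the phase space of sequents. -/
def sem : Structure α → Set (Multiset (Formula α))
  | .atom a => perp {{.lit (.pos a)}}
  | .one => perp (perp {0})
  | .bot => perp {0}
  | .par R T => perp (perp (sem R) + perp (sem T))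
  | .copar R T => perp (perp (sem R + sem T))
  | .neg R => perp (sem R)

@[simp] theorem perp_perp_sem (R : Structure α) : perp (perp (sem R)) = sem R := by
  cases R <;> simp [sem]

theorem sem_eq_of_equiv {R T : Structure α} (h : Structure.Equiv R T) : sem R = sem T := by
  induction h with
  | refl => rfl
  | symm _ h => exact h.symm
  | trans _ _ h₁ h₂ => exact h₁.trans h₂
  | par_congr _ _ h₁ h₂ => simp only [sem, h₁, h₂]
  | copar_congr _ _ h₁ h₂ => simp only [sem, h₁, h₂]
  | neg_congr _ h => simp only [sem, h]
  | par_assoc => simp only [sem, perp_add_left, perp_add_right, add_assoc]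
  | copar_assoc => simp only [sem, perp_add_left, perp_add_right, add_assoc]
  | par_comm => simp only [sem, add_comm]
  | copar_comm => simp only [sem, add_comm]
  | neg_par => simp only [sem]
  | neg_copar => simp [sem]
  | neg_neg => simp [sem]
  | neg_bot => simp only [sem]
  | neg_one => simp [sem]

theorem sem_par_bot (R : Structure α) : sem (.par R .bot) = sem R := by
  simp [sem]

theorem sem_copar_one (R : Structure α) : sem (.copar R .one) = sem R := by
  simp [sem]

/-- Weak distributivity: if `z` is orthogonal to `R + T` and `t` lies in `T`, then `z + t` is
orthogonal to `R`, so it can be tested against an element of the par of `U` and `R`. -/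
theorem sem_switch (U R T : Structure α) :
    sem (.copar (.par U R) T) ⊆ sem (.par U (.copar R T)) := by
  simp only [sem, perp_perp_perp]
  apply perp_perp_subset
  rintro _ ⟨x, hx, t, ht, rfl⟩
  rw [mem_perp_add] at hx ⊢
  intro y hy z hz
  rw [mem_perp_add] at hz
  have : z + t ∈ perp (sem R) := fun r hr => by
    have := hz r hr t ht
    rwa [show r + (z + t) = r + t + z by abel]
  have h := hx y hy _ this
  dsimp only
  rwa [show y + z + (x + t) = y + (z + t) + x by abel]

theorem sem_ruleInstance {ρ : Rule} {R T : Structure α} (h : RuleInstance ρ R T) :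
    sem T ⊆ sem R := by
  cases h with
  | aiDown a =>
    apply perp_perp_subset
    rintro _ rfl
    rw [mem_perp_add]
    intro x hx y hy
    rw [add_zero]
    exact hy x hx
  | aiUp a R =>
    rw [← perp_perp_sem R]
    simp only [sem, perp_perp_perp, perp_perp_sem]
    nth_rewrite 2 [← perp_perp_sem R]
    apply perp_anti
    intro x hx
    -- `0` is orthogonal to the copar of an atom and its negation, so `x` splits as `x + 0`.
    refine ⟨x, hx, 0, ?_, add_zero x⟩
    rw [mem_perp_add]
    intro y hy z hz
    rw [add_zero]
    exact hz y hy
  | u1Down => rw [sem_par_bot]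
  | u1Up => rw [sem_copar_one]
  | u2Down => rw [sem_copar_one]
  | u2Up => rw [sem_par_bot]
  | switch => exact sem_switch _ _ _

theorem sem_fill_mono (S : Context α) {R T : Structure α} (h : sem T ⊆ sem R) :
    sem (S.fill T) ⊆ sem (S.fill R) := by
  induction S with
  | hole => exact h
  | parLeft S V ih => exact perp_anti (Set.add_subset_add_right (perp_anti ih))
  | parRight V S ih => exact perp_anti (Set.add_subset_add_left (perp_anti ih))
  | coparLeft S V ih => exact perp_anti (perp_anti (Set.add_subset_add_right ih))
  | coparRight V S ih => exact perp_anti (perp_anti (Set.add_subset_add_left ih))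

theorem sem_step {𝒮 : System} {P Q : Structure α} (h : Step 𝒮 P Q) : sem Q ⊆ sem P := by
  obtain ⟨ρ, _, S, R, T, hr, hP, hQ⟩ := h
  rw [sem_eq_of_equiv hP, sem_eq_of_equiv hQ]
  exact sem_fill_mono S (sem_ruleInstance hr)

theorem sem_derivation {𝒮 : System} {R T : Structure α} (h : Derivation 𝒮 T R) :
    sem T ⊆ sem R := by
  induction h with
  | nil h => rw [sem_eq_of_equiv h]
  | cons h _ ih => exact ih.trans (sem_step h)

/-- Okada's lemma. -/
theorem singleton_mem_perp_sem (A : Formula α) : {A} ∈ perp (sem A.toStructure) := by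
  induction A with
  | lit l =>
    cases l with
    | pos a => exact subset_perp_perp _ rfl
    | neg a =>
      change _ ∈ perp (perp (perp _))
      rw [perp_perp_perp]
      rintro _ rfl
      exact MLL.id (.lit (.pos a))
    | one =>
      change _ ∈ perp (perp (perp _))
      rw [perp_perp_perp]
      rintro _ rfl
      rw [zero_add]
      exact MLL.one
    | bot =>
      intro x hx
      have := hx 0 rfl
      rw [zero_add] at this
      rw [add_comm]
      exact this.bot
  | par A B hA hB =>
    intro x hx
    have := mem_perp_add.1 hx _ hA _ hB
    rw [add_comm]
    apply MLL.par
    rwa [add_assoc] at this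
  | tensor A B hA hB =>
    change _ ∈ perp (perp (perp _))
    rw [perp_perp_perp, mem_perp_add]
    intro x hx y hy
    rw [add_comm]
    have h₁ := hA x hx
    have h₂ := hB y hy
    rw [add_comm] at h₁ h₂
    exact MLL.tensor h₁ h₂

/-- The sum of the orthogonals of the interpretations of the members of a sequent. -/
def semSeq (Γ : Multiset (Formula α)) : Set (Multiset (Formula α)) :=
  (Γ.map fun A => perp (sem A.toStructure)).sum

@[simp] theorem semSeq_zero : semSeq (0 : Multiset (Formula α)) = 0 := by simp [semSeq]

@[simp] theorem semSeq_cons (A : Formula α) (Γ : Multiset (Formula α)) :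
    semSeq (A ::ₘ Γ) = perp (sem A.toStructure) + semSeq Γ := by simp [semSeq]

@[simp] theorem semSeq_add (Γ Δ : Multiset (Formula α)) :
    semSeq (Γ + Δ) = semSeq Γ + semSeq Δ := by simp [semSeq]

theorem mem_semSeq (Γ : Multiset (Formula α)) : Γ ∈ semSeq Γ := by
  induction Γ using Multiset.induction with
  | empty => simp
  | cons A Γ ih =>
    rw [semSeq_cons]
    exact ⟨{A}, singleton_mem_perp_sem A, Γ, ih, rfl⟩

theorem mem_perp_perp_of_semSeq {X : Set (Multiset (Formula α))} {Γ x : Multiset (Formula α)}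
    (h : ∀ y ∈ perp X + semSeq Γ, MLL y) (hx : x ∈ semSeq Γ) : x ∈ perp (perp X) :=
  fun _ hy => h _ (Set.add_mem_add hy hx)

/-- This contains the admissibility of cut: in a provable sequent each member may be replaced by any
sequent orthogonal to its interpretation, and by Okada's lemma the other members may stand for
themselves. -/
theorem MLL.sound {Γ : Multiset (Formula α)} (h : MLL Γ) : ∀ x ∈ semSeq Γ, MLL x := by
  induction h with
  | id A =>
    simp only [semSeq_cons, semSeq_zero, add_zero, ← sem_eq_of_equiv A.equiv_neg]
    rintro _ ⟨x, hx, y, hy, rfl⟩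
    exact hy x hx
  | @tensor A B Φ Ψ _ _ h₁ h₂ =>
    simp only [semSeq_cons, semSeq_add] at h₁ h₂ ⊢
    rintro _ ⟨x, hx, _, ⟨y, hy, z, hz, rfl⟩, rfl⟩
    have hy' := mem_perp_perp_of_semSeq h₁ hy
    have hz' := mem_perp_perp_of_semSeq h₂ hz
    rw [perp_perp_sem] at hy' hz'
    change x ∈ perp (perp (perp _)) at hx
    rw [perp_perp_perp, mem_perp_add] at hx
    have := hx y hy' z hz'
    rwa [add_comm] at this
  | @par A B Φ _ h =>
    simp only [semSeq_cons] at h ⊢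
    rw [← add_assoc] at h
    rintro _ ⟨x, hx, y, hy, rfl⟩
    have : y ∈ perp (perp (sem A.toStructure) + perp (sem B.toStructure)) :=
      fun z hz => h _ (Set.add_mem_add hz hy)
    have h' := hx y this
    rwa [add_comm] at h'
  | @bot Φ _ h =>
    simp only [semSeq_cons]
    rintro _ ⟨x, hx, y, hy, rfl⟩
    have h' := hx y (by rintro _ rfl; rw [zero_add]; exact h y hy)
    rwa [add_comm] at h'
  | one =>
    simp only [semSeq_cons, semSeq_zero, add_zero]
    intro x hx
    change x ∈ perp (perp (perp _)) at hx
    rw [perp_perp_perp] at hx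
    have := hx 0 rfl
    rwa [zero_add] at this

/-! ### Semantic cut and invertible rules -/

theorem MLL.cons_of_mem {A : Formula α} {Γ x : Multiset (Formula α)} (h : MLL (A ::ₘ Γ))
    (hx : x ∈ perp (sem A.toStructure)) : MLL (x + Γ) := by
  apply h.sound
  rw [semSeq_cons]
  exact Set.add_mem_add hx (mem_semSeq Γ)

theorem MLL.mono {A B : Formula α} {Γ : Multiset (Formula α)} (h : MLL (A ::ₘ Γ))
    (hAB : sem A.toStructure ⊆ sem B.toStructure) : MLL (B ::ₘ Γ) :=
  h.cons_of_mem (perp_anti hAB (singleton_mem_perp_sem B))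

/-- The empty multiset is orthogonal to the interpretation of `⊥`, so it may replace `⊥`. -/
theorem MLL.of_bot {Γ : Multiset (Formula α)} (h : MLL (.lit .bot ::ₘ Γ)) : MLL Γ := by
  have := h.cons_of_mem (x := 0) (subset_perp_perp _ rfl)
  rwa [zero_add] at this

theorem MLL.of_par {A B : Formula α} {Γ : Multiset (Formula α)} (h : MLL (.par A B ::ₘ Γ)) :
    MLL (A ::ₘ B ::ₘ Γ) := by
  have := h.cons_of_mem (subset_perp_perp _
    (Set.add_mem_add (singleton_mem_perp_sem A) (singleton_mem_perp_sem B)))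
  rwa [add_assoc] at this

theorem Provable.mll {𝒮 : System} {R : Structure α} (h : Provable 𝒮 R) : MLL {R.toFormula} := by
  have h₀ : (0 : Multiset (Formula α)) ∈ sem R :=
    sem_derivation h (subset_perp_perp _ rfl)
  rw [sem_eq_of_equiv R.equiv_toFormula] at h₀
  have := singleton_mem_perp_sem R.toFormula 0 h₀
  rwa [zero_add] at this

end Phase

variable {α : Type*}

/-! ### Termination -/

namespace Structure

/-- The number of occurrences of atoms. -/
def width : Structure α → ℕ
  | atom _ => 1
  | one => 1
  | bot => 1
  | par R T => width R + width T
  | copar R T => width R + width T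
  | neg R => width R

/-- The number of pairs of occurrences of atoms in par relation (for `true`) or in copar relation
(for `false`). -/
def pairs : Bool → Structure α → ℕ
  | _, atom _ => 0
  | _, one => 0
  | _, bot => 0
  | b, par R T => pairs b R + pairs b T + if b then width R * width T else 0
  | b, copar R T => pairs b R + pairs b T + if b then 0 else width R * width T
  | b, neg R => pairs (!b) R

theorem width_pos (R : Structure α) : 0 < width R := by
  induction R <;> simp [width] <;> omega

theorem width_eq_of_equiv {R T : Structure α} (h : Equiv R T) : width R = width T := by
  induction h <;> simp_all [width] <;> omega

theorem pairs_eq_of_equiv {R T : Structure α} (h : Equiv R T) : ∀ b, pairs b R = pairs b T := by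
  induction h with
  | refl => exact fun _ => rfl
  | symm _ h => exact fun b => (h b).symm
  | trans _ _ h₁ h₂ => exact fun b => (h₁ b).trans (h₂ b)
  | par_congr e₁ e₂ h₁ h₂ =>
    intro b; simp only [pairs, h₁, h₂, width_eq_of_equiv e₁, width_eq_of_equiv e₂]
  | copar_congr e₁ e₂ h₁ h₂ =>
    intro b; simp only [pairs, h₁, h₂, width_eq_of_equiv e₁, width_eq_of_equiv e₂]
  | neg_congr _ h => exact fun b => h _
  | par_assoc => intro b; cases b <;> simp [pairs, width] <;> ring
  | copar_assoc => intro b; cases b <;> simp [pairs, width] <;> ring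
  | par_comm => intro b; cases b <;> simp [pairs] <;> ring
  | copar_comm => intro b; cases b <;> simp [pairs] <;> ring
  | neg_par => intro b; cases b <;> simp [pairs, width]
  | neg_copar => intro b; cases b <;> simp [pairs, width]
  | neg_neg => intro b; simp [pairs]
  | neg_bot => exact fun _ => rfl
  | neg_one => exact fun _ => rfl

/-- Switch keeps the width and lowers the number of par pairs; `u2Down` keeps the par pairs and
lowers the width. Only the sum decreases strictly under all the rules. -/
def weight (R : Structure α) : ℕ := width R + pairs true R

theorem weight_eq_of_equiv {R T : Structure α} (h : Equiv R T) : weight R = weight T := by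
  rw [weight, weight, width_eq_of_equiv h, pairs_eq_of_equiv h]

end Structure

open Structure

/-- Width and par pairs must be bounded separately, because a surrounding par multiplies the width
of the redex by that of its neighbour. -/
theorem weight_fill_lt (S : Context α) {R T : Structure α} (hw : width T ≤ width R)
    (hp : pairs true T ≤ pairs true R) (h : weight T < weight R) :
    weight (S.fill T) < weight (S.fill R) := by
  suffices width (S.fill T) ≤ width (S.fill R) ∧
      pairs true (S.fill T) ≤ pairs true (S.fill R) ∧
      weight (S.fill T) < weight (S.fill R) from this.2.2
  unfold weight at *
  induction S with
  | hole => exact ⟨hw, hp, h⟩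
  | parLeft S V ih =>
    have := Nat.mul_le_mul_right (width V) ih.1
    simp only [Context.fill, width, pairs, if_true]
    omega
  | parRight V S ih =>
    have := Nat.mul_le_mul_left (width V) ih.1
    simp only [Context.fill, width, pairs, if_true]
    omega
  | coparLeft S V ih =>
    simp only [Context.fill, width, pairs, if_true]
    omega
  | coparRight V S ih =>
    simp only [Context.fill, width, pairs, if_true]
    omega

theorem Literal.width_toStructure (l : Literal α) : width l.toStructure = 1 := by
  cases l <;> rfl

theorem Literal.pairs_toStructure (l : Literal α) (b : Bool) : pairs b l.toStructure = 0 := by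
  cases l <;> rfl

theorem weight_step {d l i : Bool} {P Q : Structure α}
    (h : Step (MLSWith (Rule.switch d l i)) P Q) : weight Q < weight P := by
  obtain ⟨ρ, hρ, S, R, T, hr, hP, hQ⟩ := h
  rw [weight_eq_of_equiv hP, weight_eq_of_equiv hQ]
  cases hr with
  | aiDown a =>
    apply weight_fill_lt <;>
      simp [weight, width, pairs, Literal.width_toStructure, Literal.pairs_toStructure]
  | aiUp => simp [MLSWith, MLSu] at hρ
  | u1Up => simp [MLSWith, MLSu] at hρ
  | u2Up => simp [MLSWith, MLSu] at hρ
  | u1Down => apply weight_fill_lt <;> simp [weight, width, pairs]; omega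
  | u2Down => apply weight_fill_lt <;> simp [weight, width, pairs]
  | switch d l i U R T =>
    -- The pairs between `U` and `T` pass from par to copar relation; this is the whole decrease.
    have h : 0 < width U * width T := Nat.mul_pos U.width_pos T.width_pos
    apply weight_fill_lt <;> simp only [weight, width, pairs, if_true, Nat.mul_add] <;> omega

/-! ### Steps -/

namespace Step

variable {𝒮 : System}

theorem of_instance {ρ : Rule} {R T : Structure α} (hρ : ρ ∈ 𝒮) (h : RuleInstance ρ R T) :
    Step 𝒮 R T :=
  ⟨ρ, hρ, .hole, R, T, h, .refl _, .refl _⟩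

theorem equiv {P P' Q Q' : Structure α} (h : Step 𝒮 P Q) (hP : Equiv P' P) (hQ : Equiv Q' Q) :
    Step 𝒮 P' Q' := by
  obtain ⟨ρ, hρ, S, R, T, hr, h₁, h₂⟩ := h
  exact ⟨ρ, hρ, S, R, T, hr, hP.trans h₁, hQ.trans h₂⟩

theorem par_right {P Q : Structure α} (h : Step 𝒮 P Q) (V : Structure α) :
    Step 𝒮 (.par P V) (.par Q V) := by
  obtain ⟨ρ, hρ, S, R, T, hr, h₁, h₂⟩ := h
  exact ⟨ρ, hρ, .parLeft S V, R, T, hr, .par_congr h₁ (.refl _), .par_congr h₂ (.refl _)⟩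

theorem copar_right {P Q : Structure α} (h : Step 𝒮 P Q) (V : Structure α) :
    Step 𝒮 (.copar P V) (.copar Q V) := by
  obtain ⟨ρ, hρ, S, R, T, hr, h₁, h₂⟩ := h
  exact ⟨ρ, hρ, .coparLeft S V, R, T, hr, .copar_congr h₁ (.refl _), .copar_congr h₂ (.refl _)⟩

end Step

/-! ### Interaction -/

theorem Structure.atomSet_eq_of_equiv {R T : Structure α} (h : Equiv R T) :
    R.atomSet = T.atomSet := by
  induction h with
  | refl => rfl
  | symm _ h => exact h.symm
  | trans _ _ h₁ h₂ => exact h₁.trans h₂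
  | par_congr _ _ h₁ h₂ => simp only [atomSet, h₁, h₂]
  | copar_congr _ _ h₁ h₂ => simp only [atomSet, h₁, h₂]
  | neg_congr _ h => simp only [atomSet, h]
  | par_assoc => simp only [atomSet, Set.union_assoc]
  | copar_assoc => simp only [atomSet, Set.union_assoc]
  | par_comm => simp only [atomSet, Set.union_comm]
  | copar_comm => simp only [atomSet, Set.union_comm]
  | neg_par => simp only [atomSet, Set.image_union]
  | neg_copar => simp only [atomSet, Set.image_union]
  | neg_neg => simp [atomSet, Set.image_image]
  | neg_bot => simp [atomSet, Literal.dual]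
  | neg_one => simp [atomSet, Literal.dual]

theorem interacts_iff {R U : Structure α} :
    Interacts R U ↔ ∃ l ∈ R.atomSet, l.dual ∈ U.atomSet := by
  constructor
  · rintro ⟨_, ⟨l, hl, rfl⟩, h⟩
    exact ⟨l, hl, h⟩
  · rintro ⟨l, hl, h⟩
    exact ⟨_, ⟨l, hl, rfl⟩, h⟩

theorem Interacts.symm {R U : Structure α} (h : Interacts R U) : Interacts U R := by
  obtain ⟨l, hl, h⟩ := interacts_iff.1 h
  exact interacts_iff.2 ⟨l.dual, h, by rwa [Literal.dual_dual]⟩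

theorem Interacts.mono {R R' U : Structure α} (h : Interacts R U)
    (hR : R.atomSet ⊆ R'.atomSet) : Interacts R' U := by
  obtain ⟨l, hl, h⟩ := interacts_iff.1 h
  exact interacts_iff.2 ⟨l, hR hl, h⟩

/-! ### Progress -/

/-- A step of `MLSdli` between formulae. -/
def FStep (A B : Formula α) : Prop := Step MLSdli A.toStructure B.toStructure

def FInteracts (A B : Formula α) : Prop := Interacts A.toStructure B.toStructure

/-- A provable sequent with this property can be rewritten by `MLSdli` to a provable sequent,
inside one of its members or by making two members interact, unless `⊥` occurs in it. -/
inductive HasStep (Γ : Multiset (Formula α)) : Prop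
  | inside {A B : Formula α} {Δ : Multiset (Formula α)} :
      Γ = A ::ₘ Δ → FStep A B → MLL (B ::ₘ Δ) → HasStep Γ
  | across {A B C : Formula α} {Δ : Multiset (Formula α)} :
      Γ = A ::ₘ B ::ₘ Δ → FInteracts A B → FStep (.par A B) C → MLL (C ::ₘ Δ) → HasStep Γ
  | bot : Formula.lit Literal.bot ∈ Γ → HasStep Γ

theorem cons_eq_cons_cons {β : Type*} {a b c : β} {s t : Multiset β}
    (h : c ::ₘ s = a ::ₘ b ::ₘ t) :
    (a = c ∧ s = b ::ₘ t) ∨ (b = c ∧ s = a ::ₘ t) ∨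
      ∃ u, t = c ::ₘ u ∧ s = a ::ₘ b ::ₘ u := by
  rcases Multiset.cons_eq_cons.1 h with ⟨h', h⟩ | ⟨_, u, h₁, h₂⟩
  · exact .inl ⟨h'.symm, h⟩
  · rcases Multiset.cons_eq_cons.1 h₂ with ⟨rfl, rfl⟩ | ⟨_, v, rfl, rfl⟩
    · exact .inr (.inl ⟨rfl, h₁⟩)
    · exact .inr (.inr ⟨v, rfl, h₁⟩)

theorem FStep.par_comm {A B C : Formula α} (h : FStep (.par A B) C) : FStep (.par B A) C :=
  Step.equiv h (.par_comm _ _) (.refl _)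

/-- The step of a sequent, analysed with respect to a given member. -/
theorem HasStep.cases_cons {A : Formula α} {Γ : Multiset (Formula α)} (h : HasStep (A ::ₘ Γ)) :
    (∃ B, FStep A B ∧ MLL (B ::ₘ Γ)) ∨
    (∃ B C Δ, Γ = B ::ₘ Δ ∧ FInteracts A B ∧ FStep (.par A B) C ∧ MLL (C ::ₘ Δ)) ∨
    (∃ B C Δ, Γ = B ::ₘ Δ ∧ FStep B C ∧ MLL (C ::ₘ A ::ₘ Δ)) ∨
    (∃ B C D Δ, Γ = B ::ₘ C ::ₘ Δ ∧ FInteracts B C ∧ FStep (.par B C) D ∧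
      MLL (D ::ₘ A ::ₘ Δ)) ∨
    A = .lit .bot ∨ .lit .bot ∈ Γ := by
  cases h with
  | @inside B C Δ h hs hm =>
    rcases Multiset.cons_eq_cons.1 h with ⟨rfl, rfl⟩ | ⟨_, Θ, rfl, rfl⟩
    · exact .inl ⟨C, hs, hm⟩
    · exact .inr (.inr (.inl ⟨B, C, Θ, rfl, hs, hm⟩))
  | @across B C D Δ h hi hs hm =>
    rcases cons_eq_cons_cons h with ⟨rfl, rfl⟩ | ⟨rfl, rfl⟩ | ⟨Θ, rfl, rfl⟩
    · exact .inr (.inl ⟨C, D, Δ, rfl, hi, hs, hm⟩)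
    · exact .inr (.inl ⟨B, D, Δ, rfl, hi.symm, hs.par_comm, hm⟩)
    · exact .inr (.inr (.inr (.inl ⟨B, C, D, Θ, rfl, hi, hs, hm⟩)))
  | bot h =>
    rcases Multiset.mem_cons.1 h with h | h
    · exact .inr (.inr (.inr (.inr (.inl h.symm))))
    · exact .inr (.inr (.inr (.inr (.inr h))))

theorem FStep.par_right {A C : Formula α} (h : FStep A C) (B : Formula α) :
    FStep (.par A B) (.par C B) :=
  Step.par_right h _

theorem mem_mlsdli_switch : Rule.dlis ∈ MLSdli := Or.inr rfl

theorem mem_mlsdli_aiDown : Rule.aiDown ∈ MLSdli := by simp [MLSdli, MLSWith, MLSu, SMLS]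

theorem mem_mlsdli_u1Down : Rule.u1Down ∈ MLSdli := by simp [MLSdli, MLSWith, MLSu, SMLS]

theorem mem_mlsdli_u2Down : Rule.u2Down ∈ MLSdli := by simp [MLSdli, MLSWith, MLSu, SMLS]

theorem FStep.bot_par (A : Formula α) : FStep (.par (.lit .bot) A) A :=
  Step.equiv (Step.of_instance mem_mlsdli_u1Down (.u1Down _)) (.par_comm _ _) (.refl _)

theorem FInteracts.par {A A' B : Formula α} (h : FInteracts A B) : FInteracts (.par A A') B :=
  Interacts.mono h Set.subset_union_left

theorem FInteracts.symm {A B : Formula α} (h : FInteracts A B) : FInteracts B A :=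
  Interacts.symm h

theorem par_right_comm (R T U : Structure α) : Equiv (.par (.par R T) U) (.par (.par R U) T) :=
  (Equiv.par_assoc _ _ _).trans
    ((Equiv.par_congr (.refl _) (.par_comm _ _)).trans (Equiv.par_assoc _ _ _).symm)

/-- Interaction survives the gluing of `A` and `B`, since the set of atoms only grows, and a step
across `A` and `B` becomes a step inside their par. If one of them is `⊥`, the par gives `u1Down` a
redex, which a `⊥` standing alone does not; hence the third alternative in `HasStep`. -/
theorem HasStep.par {A B : Formula α} {Γ : Multiset (Formula α)} (h : HasStep (A ::ₘ B ::ₘ Γ))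
    (hm : MLL (A ::ₘ B ::ₘ Γ)) : HasStep (.par A B ::ₘ Γ) := by
  rcases h.cases_cons with ⟨C, hs, hc⟩ | ⟨C, D, Δ, e, hi, hs, hc⟩ | ⟨C, D, Δ, e, hs, hc⟩ |
    ⟨C, D, E, Δ, e, hi, hs, hc⟩ | rfl | h
  · exact .inside rfl (hs.par_right B) hc.par
  · rcases Multiset.cons_eq_cons.1 e with ⟨rfl, rfl⟩ | ⟨_, Θ, rfl, rfl⟩
    · exact .inside rfl hs hc
    · refine .across (C := .par D B) rfl hi.par ?_ hc.par
      exact Step.equiv (hs.par_right B) (par_right_comm _ _ _) (.refl _)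
  · rcases Multiset.cons_eq_cons.1 e with ⟨rfl, rfl⟩ | ⟨_, Θ, rfl, rfl⟩
    · exact .inside rfl (hs.par_right A).par_comm hc.par
    · rw [Multiset.cons_swap, Multiset.cons_swap D] at hc
      refine .inside (Multiset.cons_swap _ _ _) hs ?_
      rw [Multiset.cons_swap]
      exact hc.par
  · rcases cons_eq_cons_cons e with ⟨rfl, rfl⟩ | ⟨rfl, rfl⟩ | ⟨Θ, rfl, rfl⟩
    · refine .across (C := .par E A) rfl (A := .par A C) ?_ ?_ hc.par
      · exact Interacts.mono hi Set.subset_union_right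
      · refine Step.equiv (hs.par_right A) ?_ (.refl _)
        exact (Equiv.par_assoc _ _ _).trans (.par_comm _ _)
    · refine .across (C := .par E A) rfl (A := .par A D) ?_ ?_ hc.par
      · exact Interacts.mono hi.symm Set.subset_union_right
      · refine Step.equiv (hs.par_comm.par_right A) ?_ (.refl _)
        exact (Equiv.par_assoc _ _ _).trans (.par_comm _ _)
    · refine .across (A := C) (B := D) (C := E) (Δ := .par A B ::ₘ Θ) ?_ hi hs ?_
      · rw [Multiset.cons_swap, Multiset.cons_swap _ D]
      · rw [Multiset.cons_swap]
        apply MLL.par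
        rwa [Multiset.cons_swap B, Multiset.cons_swap A]
  · exact .inside rfl (FStep.bot_par B) hm.of_bot
  · rcases Multiset.mem_cons.1 h with rfl | h
    · rw [Multiset.cons_swap] at hm
      exact .inside rfl (FStep.bot_par A).par_comm hm.of_bot
    · exact .bot (Multiset.mem_cons_of_mem h)

/-- No member of the sequent is a par or `⊥`. -/
def Flat (Γ : Multiset (Formula α)) : Prop :=
  ∀ A ∈ Γ, (∀ B C, A ≠ .par B C) ∧ A ≠ .lit .bot

/-- The last rule of a proof of a flat sequent. -/
theorem MLL.last_rule {Γ : Multiset (Formula α)} (h : MLL Γ) (hΓ : Flat Γ) :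
    Γ = {.lit .one} ∨ (∃ a, Γ = .lit (.pos a) ::ₘ .lit (.neg a) ::ₘ 0) ∨
    ∃ A B Φ Ψ, Γ = .tensor A B ::ₘ (Φ + Ψ) ∧ MLL (A ::ₘ Φ) ∧ MLL (B ::ₘ Ψ) := by
  cases h with
  | id A =>
    have h₁ := hΓ A (by simp)
    have h₂ := hΓ A.dual (by simp)
    cases A with
    | lit l =>
      cases l with
      | pos a => exact .inr (.inl ⟨a, rfl⟩)
      | neg a => exact .inr (.inl ⟨a, Multiset.cons_swap _ _ _⟩)
      | one => exact absurd rfl h₂.2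
      | bot => exact absurd rfl h₁.2
    | par A B => exact absurd rfl (h₁.1 A B)
    | tensor A B => exact absurd rfl (h₂.1 A.dual B.dual)
  | @tensor A B Φ Ψ h₁ h₂ => exact .inr (.inr ⟨A, B, Φ, Ψ, rfl, h₁, h₂⟩)
  | @par A B => exact absurd rfl ((hΓ _ (Multiset.mem_cons_self _ _)).1 A B)
  | bot => exact absurd rfl (hΓ _ (Multiset.mem_cons_self _ _)).2
  | one => exact .inl rfl

/-! ### Size of sequents and splitting tensors -/

def Formula.size : Formula α → ℕ
  | .lit _ => 1
  | .par A B => A.size + B.size + 1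
  | .tensor A B => A.size + B.size + 1

theorem Formula.size_pos (A : Formula α) : 0 < A.size := by
  cases A <;> simp [Formula.size]

def seqSize (Γ : Multiset (Formula α)) : ℕ := (Γ.map Formula.size).sum

@[simp] theorem seqSize_cons (A : Formula α) (Γ : Multiset (Formula α)) :
    seqSize (A ::ₘ Γ) = A.size + seqSize Γ := by simp [seqSize]

@[simp] theorem seqSize_add (Γ Δ : Multiset (Formula α)) :
    seqSize (Γ + Δ) = seqSize Γ + seqSize Δ := by simp [seqSize]

/-- `Γ` contains a formula `A ⊗ B`, up to equivalence, such that `A, Φ` and `B, Γ \ Φ` are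
provable. -/
def Splits (Γ : Multiset (Formula α)) (A : Formula α) (Φ : Multiset (Formula α)) : Prop :=
  ∃ X B Ψ, Γ = X ::ₘ (Φ + Ψ) ∧ Equiv X.toStructure (.copar A.toStructure B.toStructure) ∧
    MLL (A ::ₘ Φ) ∧ MLL (B ::ₘ Ψ)

theorem MLL.of_equiv {A B : Formula α} {Γ : Multiset (Formula α)} (h : MLL (A ::ₘ Γ))
    (e : Equiv A.toStructure B.toStructure) : MLL (B ::ₘ Γ) :=
  h.mono (sem_eq_of_equiv e).subset

/-- The left component of a split that is a tensor can be replaced by a smaller one. -/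
theorem Splits.descend {Γ Φ : Multiset (Formula α)} {A₁ A₂ : Formula α} (hΓ : Flat Γ)
    (h : Splits Γ (.tensor A₁ A₂) Φ) :
    ∃ A' Φ', Splits Γ A' Φ' ∧ seqSize (A' ::ₘ Φ') < seqSize (.tensor A₁ A₂ ::ₘ Φ) := by
  obtain ⟨X, B, Ψ, rfl, e, hA, hB⟩ := h
  have hflat : Flat (.tensor A₁ A₂ ::ₘ Φ) := by
    intro C hC
    rcases Multiset.mem_cons.1 hC with rfl | hC
    · simp
    · exact hΓ C (by simp [hC])
  rcases hA.last_rule hflat with h | ⟨a, h⟩ | ⟨C, D, Φ₁, Φ₂, h, h₁, h₂⟩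
  · have : Formula.tensor A₁ A₂ ∈ ({.lit .one} : Multiset (Formula α)) := h ▸ by simp
    simp at this
  · have : Formula.tensor A₁ A₂ ∈ (.lit (.pos a) ::ₘ .lit (.neg a) ::ₘ 0 : Multiset (Formula α)) :=
      h ▸ by simp
    simp at this
  · rw [h]
    rcases Multiset.cons_eq_cons.1 h with ⟨hCD, rfl⟩ | ⟨_, Θ, rfl, hΘ⟩
    · cases hCD
      -- The tensor itself is principal: `(A₁ ⊗ A₂) ⊗ B` is reassociated as `A₁ ⊗ (A₂ ⊗ B)`.
      refine ⟨A₁, Φ₁, ⟨X, .tensor A₂ B, Φ₂ + Ψ, by rw [add_assoc],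
        e.trans (.copar_assoc _ _ _), h₁, h₂.tensor hB⟩, ?_⟩
      simp [Formula.size]
      omega
    -- Another tensor, of `C` and `D`, is principal. The two tensor rules are permuted: the premise
    -- without `A₁ ⊗ A₂` is the new left component, and the other one is first combined with `B, Ψ`
    -- to restore `X`.
    · have key {C D : Formula α} {Φ₁ Φ₂ : Multiset (Formula α)} {Y : Formula α}
          (hY : Equiv Y.toStructure (.copar D.toStructure C.toStructure))
          (h₁ : MLL (C ::ₘ Φ₁)) (h₂ : MLL (D ::ₘ Φ₂)) (hm : .tensor A₁ A₂ ∈ Φ₁)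
          (hΘ : Φ₁ + Φ₂ = .tensor A₁ A₂ ::ₘ Θ) :
          Splits (X ::ₘ (Y ::ₘ Θ + Ψ)) D Φ₂ := by
        obtain ⟨Φ₁, rfl⟩ := Multiset.exists_cons_of_mem hm
        rw [Multiset.cons_add, Multiset.cons_inj_right] at hΘ
        subst hΘ
        refine ⟨Y, C, X ::ₘ (Φ₁ + Ψ), ?_, hY, h₂, ?_⟩
        · rw [Multiset.add_cons, Multiset.cons_add, Multiset.cons_swap]
          congr 2
          abel
        · rw [Multiset.cons_swap] at h₁ ⊢
          have := h₁.tensor hB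
          rw [Multiset.cons_add] at this
          exact this.of_equiv e.symm
      have hm : Formula.tensor A₁ A₂ ∈ Φ₁ + Φ₂ := by rw [hΘ]; simp
      have hC := C.size_pos
      have hD := D.size_pos
      rcases Multiset.mem_add.1 hm with hm | hm
      · refine ⟨D, Φ₂, key (.copar_comm _ _) h₁ h₂ hm hΘ, ?_⟩
        simp [Formula.size]
        omega
      · refine ⟨C, Φ₁, key (.refl _) h₂ h₁ hm (by rw [add_comm, hΘ]), ?_⟩
        simp [Formula.size]
        omega

/-- The size bound keeps the left premise within reach of the induction in `MLL.hasStep`. -/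
theorem Splits.exists_ne_tensor {Γ Φ : Multiset (Formula α)} {A : Formula α} (hΓ : Flat Γ)
    (h : Splits Γ A Φ) :
    ∃ A' Φ', Splits Γ A' Φ' ∧ seqSize (A' ::ₘ Φ') ≤ seqSize (A ::ₘ Φ) ∧
      ∀ B C, A' ≠ .tensor B C := by
  induction hn : seqSize (A ::ₘ Φ) using Nat.strong_induction_on generalizing A Φ with
  | _ n ih =>
    subst hn
    by_cases hA : ∀ B C, A ≠ .tensor B C
    · exact ⟨A, Φ, h, le_rfl, hA⟩
    · push Not at hA
      obtain ⟨B, C, rfl⟩ := hA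
      obtain ⟨A', Φ', h', hlt⟩ := h.descend hΓ
      obtain ⟨A'', Φ'', h'', hle, hA⟩ := ih _ hlt h' rfl
      exact ⟨A'', Φ'', h'', hle.trans hlt.le, hA⟩

theorem FStep.u2Down {X B : Formula α}
    (e : Equiv X.toStructure (.copar (Formula.lit .one).toStructure B.toStructure)) :
    FStep X B :=
  Step.equiv (Step.of_instance mem_mlsdli_u2Down (.u2Down _)) (e.trans (.copar_comm _ _)) (.refl _)

theorem FStep.switch {X A B V : Formula α} (hA : ∀ C D, A ≠ .tensor C D) (hA' : A ≠ .lit .one)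
    (hV : ∀ C D, V ≠ .par C D) (hV' : V ≠ .lit .bot) (hi : FInteracts A V)
    (e : Equiv X.toStructure (.copar A.toStructure B.toStructure)) :
    FStep (.par X V) (.tensor (.par A V) B) := by
  have hd : DeepCond A.toStructure := by
    cases A with
    | lit l => exact .inr ⟨l, by rintro rfl; exact hA' rfl, .refl _⟩
    | par C D => exact .inl ⟨_, _, .refl _⟩
    | tensor C D => exact absurd rfl (hA C D)
  have hl : LazyCond V.toStructure := by
    cases V with
    | lit l => exact .inr ⟨l, by rintro rfl; exact hV' rfl, .refl _⟩
    | tensor C D => exact .inl ⟨_, _, .refl _⟩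
    | par C D => exact absurd rfl (hV C D)
  exact Step.equiv (Step.of_instance mem_mlsdli_switch
    (.switch _ _ _ V.toStructure A.toStructure B.toStructure (fun _ => hd) (fun _ => hl)
      (fun _ => hi)))
    ((Equiv.par_comm _ _).trans (.par_congr (.refl _) e))
    (.copar_congr (.par_comm _ _) (.refl _))

theorem FStep.copar {X A A' B : Formula α} (h : FStep A A')
    (e : Equiv X.toStructure (.copar A.toStructure B.toStructure)) :
    FStep X (.tensor A' B) :=
  Step.equiv (Step.copar_right h _) e (.refl _)

/-- A provable sequent other than `1` can be rewritten to a provable sequent. -/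
theorem MLL.hasStep {Γ : Multiset (Formula α)} (h : MLL Γ) :
    Γ = {.lit .one} ∨ HasStep Γ := by
  induction hn : seqSize Γ using Nat.strong_induction_on generalizing Γ with
  | _ n ih =>
    subst hn
    by_cases hflat : Flat Γ
    swap
    · refine .inr ?_
      unfold Flat at hflat
      push Not at hflat
      obtain ⟨A, hA, hA'⟩ := hflat
      by_cases hpar : ∀ B C, A ≠ .par B C
      · exact .bot (hA' hpar ▸ hA)
      · push Not at hpar
        obtain ⟨B, C, rfl⟩ := hpar
        obtain ⟨Δ, rfl⟩ := Multiset.exists_cons_of_mem hA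
        rcases ih _ (by simp [Formula.size]; omega) h.of_par rfl with h' | h'
        · have := congrArg Multiset.card h'
          simp at this
        · exact h'.par h.of_par
    rcases h.last_rule hflat with h' | ⟨a, rfl⟩ | ⟨A, B, Φ, Ψ, hΓ, hA, hB⟩
    · exact .inl h'
    · refine .inr (.across rfl ?_ (Step.of_instance mem_mlsdli_aiDown (.aiDown (.pos a)))
        (C := .lit .one) MLL.one)
      exact interacts_iff.2 ⟨.pos a, rfl, _, rfl, rfl⟩
    refine .inr ?_
    have hlt : seqSize (A ::ₘ Φ) < seqSize Γ := by
      rw [hΓ]; simp [Formula.size]; omega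
    obtain ⟨A, Φ, ⟨X, B, Ψ, rfl, e, hA, hB⟩, hle, hne⟩ :=
      Splits.exists_ne_tensor hflat ⟨_, B, Ψ, hΓ, .refl _, hA, hB⟩
    replace hlt := hle.trans_lt hlt
    have hΦ : Flat Φ := fun C hC => hflat C (by simp [hC])
    by_cases hone : A = .lit .one
    · subst hone
      refine .inside rfl (FStep.u2Down e) (h.mono ?_)
      rw [sem_eq_of_equiv (e.trans (.copar_comm _ _))]
      exact (sem_copar_one _).subset
    -- Replace `A, Δ` by `X, Δ, Ψ`.
    have glue {Δ : Multiset (Formula α)} (h : MLL (A ::ₘ Δ)) : MLL (X ::ₘ (Δ + Ψ)) :=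
      (h.tensor hB).of_equiv e.symm
    have hX : A.toStructure.atomSet ⊆ X.toStructure.atomSet := by
      rw [atomSet_eq_of_equiv e]
      exact Set.subset_union_left
    -- Only the interaction of `A` with `V` is used: the step found across them is not performed.
    -- The new sequent is provable because `A, V, Δ` is.
    have switch {V : Formula α} {Δ : Multiset (Formula α)} (hV : Φ = V ::ₘ Δ)
        (hi : FInteracts A V) : HasStep (X ::ₘ (Φ + Ψ)) := by
      subst hV
      have hV := hΦ V (by simp)
      exact .across (by rw [Multiset.cons_add]) (hi.mono hX)
        (FStep.switch hne hone hV.1 hV.2 hi e) (hA.par.tensor hB)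
    have inside {C D : Formula α} {Δ : Multiset (Formula α)} (hC : Φ = C ::ₘ Δ) (hs : FStep C D)
        (hm : MLL (D ::ₘ A ::ₘ Δ)) : HasStep (X ::ₘ (Φ + Ψ)) := by
      subst hC
      refine .inside (by rw [Multiset.cons_add, Multiset.cons_swap]) hs ?_
      rw [Multiset.cons_swap] at hm ⊢
      simpa using glue hm
    have across {C D E : Formula α} {Δ : Multiset (Formula α)} (hC : Φ = C ::ₘ D ::ₘ Δ)
        (hi : FInteracts C D) (hs : FStep (.par C D) E) (hm : MLL (E ::ₘ A ::ₘ Δ)) :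
        HasStep (X ::ₘ (Φ + Ψ)) := by
      subst hC
      refine .across (Δ := X ::ₘ (Δ + Ψ)) ?_ hi hs ?_
      · rw [Multiset.cons_add, Multiset.cons_add, Multiset.cons_swap, Multiset.cons_swap X]
      · rw [Multiset.cons_swap] at hm ⊢
        simpa using glue hm
    have notbot : .lit .bot ∉ Φ := fun h => (hΦ _ h).2 rfl
    rcases ih _ hlt hA rfl with h' | h'
    · exact absurd (Multiset.mem_singleton.1 (h' ▸ Multiset.mem_cons_self A Φ)) hone
    rcases h'.cases_cons with ⟨C, hs, hC⟩ | ⟨V, C, Δ, hV, hi, -, -⟩ | ⟨C, D, Δ, hC, hs, hm⟩ |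
      ⟨C, D, E, Δ, hC, hi, hs, hm⟩ | rfl | hbot
    · exact .inside rfl (hs.copar e) (hC.tensor hB)
    · exact switch hV hi
    · exact inside hC hs hm
    · exact across hC hi hs hm
    -- Here `A` is `⊥`, which can be dropped, so the induction applies to `Φ`. If `Φ` is just `1`,
    -- it interacts with `⊥` and is switched in; otherwise the step of `Φ` is kept and `⊥` is put
    -- back.
    · rcases ih _ (lt_of_le_of_lt (by simp) hlt) hA.of_bot rfl with rfl | h''
      · exact switch (Δ := 0) rfl (interacts_iff.2 ⟨.bot, rfl, rfl⟩)
      · cases h'' with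
        | inside hC hs hm => exact inside hC hs (by rw [Multiset.cons_swap]; exact hm.bot)
        | across hC hi hs hm => exact across hC hi hs (by rw [Multiset.cons_swap]; exact hm.bot)
        | bot h => exact absurd h notbot
    · exact absurd hbot notbot

theorem not_mll_zero : ¬ MLL (0 : Multiset (Formula α)) := by
  intro h
  generalize hΓ : (0 : Multiset (Formula α)) = Γ at h
  cases h <;> simp at hΓ

theorem MLL.exists_fstep {A : Formula α} (h : MLL {A}) :
    A = .lit .one ∨ ∃ B, FStep A B ∧ MLL {B} := by
  rcases h.hasStep with h' | h'
  · exact .inl (Multiset.singleton_inj.1 h')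
  · refine .inr ?_
    rcases HasStep.cases_cons (Γ := 0) h' with ⟨C, hs, hC⟩ | ⟨V, C, Δ, hV, -⟩ | ⟨C, D, Δ, hC, -⟩ |
      ⟨C, D, E, Δ, hC, -⟩ | rfl | hbot
    · exact ⟨C, hs, hC⟩
    · exact absurd hV (Multiset.zero_ne_cons)
    · exact absurd hC (Multiset.zero_ne_cons)
    · exact absurd hC (Multiset.zero_ne_cons)
    -- A proof of `⊥` alone would give one of the empty sequent.
    · exact absurd (MLL.of_bot h) not_mll_zero
    · simp at hbot

theorem MLL.provable_toStructure {A : Formula α} (h : MLL {A}) :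
    Provable MLSdli A.toStructure := by
  induction hn : weight A.toStructure using Nat.strong_induction_on generalizing A with
  | _ n ih =>
    subst hn
    rcases h.exists_fstep with rfl | ⟨B, hs, hB⟩
    · exact .nil (.refl _)
    · exact .cons hs (ih _ (weight_step hs) hB rfl)

/-! ### Completeness -/

theorem RuleInstance.weaken_switch {R T : Structure α} (d l i : Bool)
    (h : RuleInstance Rule.dlis R T) : RuleInstance (Rule.switch d l i) R T := by
  cases h with
  | switch _ _ _ U R T hd hl hi =>
    exact .switch d l i U R T (fun _ => hd rfl) (fun _ => hl rfl) (fun _ => hi rfl)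

theorem Step.of_mlsdli {𝒮 : System} {d l i : Bool} (hai : Rule.aiDown ∈ 𝒮)
    (hu1 : Rule.u1Down ∈ 𝒮) (hu2 : Rule.u2Down ∈ 𝒮) (hs : Rule.switch d l i ∈ 𝒮)
    {P Q : Structure α} (h : Step MLSdli P Q) : Step 𝒮 P Q := by
  obtain ⟨ρ, hρ, S, R, T, hr, hP, hQ⟩ := h
  have hρ' : ρ = .aiDown ∨ ρ = .u1Down ∨ ρ = .u2Down ∨ ρ = .dlis := by
    simp [MLSdli, MLSWith, MLSu, SMLS] at hρ
    tauto
  rcases hρ' with rfl | rfl | rfl | rfl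
  · exact ⟨_, hai, S, R, T, hr, hP, hQ⟩
  · exact ⟨_, hu1, S, R, T, hr, hP, hQ⟩
  · exact ⟨_, hu2, S, R, T, hr, hP, hQ⟩
  · exact ⟨_, hs, S, R, T, hr.weaken_switch d l i, hP, hQ⟩

theorem Derivation.of_equiv {𝒮 : System} {R R' T : Structure α} (h : Derivation 𝒮 T R)
    (e : Equiv R' R) : Derivation 𝒮 T R' := by
  cases h with
  | nil h => exact .nil (e.trans h)
  | cons hs h => exact .cons (hs.equiv e (.refl _)) h

theorem Derivation.of_mlsdli {𝒮 : System} {d l i : Bool} (hai : Rule.aiDown ∈ 𝒮)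
    (hu1 : Rule.u1Down ∈ 𝒮) (hu2 : Rule.u2Down ∈ 𝒮) (hs : Rule.switch d l i ∈ 𝒮)
    {R T : Structure α} (h : Derivation MLSdli T R) : Derivation 𝒮 T R := by
  induction h with
  | nil h => exact .nil h
  | cons hs' _ ih => exact .cons (hs'.of_mlsdli hai hu1 hu2 hs) ih

/-- Every system with the down rules and some form of switch is complete. -/
theorem completeForMLL {𝒮 : System} {d l i : Bool} (hai : Rule.aiDown ∈ 𝒮)
    (hu1 : Rule.u1Down ∈ 𝒮) (hu2 : Rule.u2Down ∈ 𝒮) (hs : Rule.switch d l i ∈ 𝒮) :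
    CompleteForMLL α 𝒮 := fun R =>
  ⟨Provable.mll, fun h =>
    (Derivation.of_mlsdli hai hu1 hu2 hs h.provable_toStructure).of_equiv R.equiv_toFormula⟩

theorem completeForMLL_mlsWith (d l i : Bool) :
    CompleteForMLL α (MLSWith (Rule.switch d l i)) :=
  completeForMLL (by simp [MLSWith, MLSu, SMLS]) (by simp [MLSWith, MLSu, SMLS])
    (by simp [MLSWith, MLSu, SMLS]) (Or.inr rfl)

theorem completeForMLL_mlsu : CompleteForMLL α MLSu := by
  apply completeForMLL (d := false) (l := false) (i := false) <;> simp [MLSu, SMLS]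

theorem completeForMLL_mls : CompleteForMLL α MLS := by
  apply completeForMLL (d := false) (l := false) (i := false) <;> simp [MLS, SMLS]

theorem CompleteForMLL.systemEquivalent {𝒮 𝒯 : System} (h₁ : CompleteForMLL α 𝒮)
    (h₂ : CompleteForMLL α 𝒯) : SystemEquivalent α 𝒮 𝒯 :=
  fun R => (h₁ R).trans (h₂ R).symm

end DeepMLL

theorem mainTheorem2 (α : Type*) [Countable α] :
    (∀ 𝒮 ∈ ({DeepMLL.MLS, DeepMLL.MLSu, DeepMLL.MLSl, DeepMLL.MLSd, DeepMLL.MLSdl,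
          DeepMLL.MLSdli} : Set DeepMLL.System),
      ∀ 𝒯 ∈ ({DeepMLL.MLS, DeepMLL.MLSu, DeepMLL.MLSl, DeepMLL.MLSd, DeepMLL.MLSdl,
          DeepMLL.MLSdli} : Set DeepMLL.System),
        DeepMLL.SystemEquivalent α 𝒮 𝒯) ∧
    (∀ 𝒮 ∈ ({DeepMLL.MLSu, DeepMLL.MLSl, DeepMLL.MLSd, DeepMLL.MLSi, DeepMLL.MLSdl,
          DeepMLL.MLSli, DeepMLL.MLSdi, DeepMLL.MLSdli} : Set DeepMLL.System),
      ∀ 𝒯 ∈ ({DeepMLL.MLSu, DeepMLL.MLSl, DeepMLL.MLSd, DeepMLL.MLSi, DeepMLL.MLSdl,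
          DeepMLL.MLSli, DeepMLL.MLSdi, DeepMLL.MLSdli} : Set DeepMLL.System),
        DeepMLL.SystemEquivalent α 𝒮 𝒯) ∧
    (∀ 𝒮 ∈ ({DeepMLL.MLSu, DeepMLL.MLSl, DeepMLL.MLSd, DeepMLL.MLSi, DeepMLL.MLSdl,
          DeepMLL.MLSli, DeepMLL.MLSdi, DeepMLL.MLSdli} : Set DeepMLL.System),
      DeepMLL.CompleteForMLL α 𝒮) := by
  have h₁ : ∀ 𝒮 ∈ ({DeepMLL.MLS, DeepMLL.MLSu, DeepMLL.MLSl, DeepMLL.MLSd, DeepMLL.MLSdl,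
      DeepMLL.MLSdli} : Set DeepMLL.System), DeepMLL.CompleteForMLL α 𝒮 := by
    rintro 𝒮 (rfl | rfl | rfl | rfl | rfl | rfl)
    · exact DeepMLL.completeForMLL_mls
    · exact DeepMLL.completeForMLL_mlsu
    all_goals exact DeepMLL.completeForMLL_mlsWith _ _ _
  have h₂ : ∀ 𝒮 ∈ ({DeepMLL.MLSu, DeepMLL.MLSl, DeepMLL.MLSd, DeepMLL.MLSi, DeepMLL.MLSdl,
      DeepMLL.MLSli, DeepMLL.MLSdi, DeepMLL.MLSdli} : Set DeepMLL.System),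
      DeepMLL.CompleteForMLL α 𝒮 := by
    rintro 𝒮 (rfl | rfl | rfl | rfl | rfl | rfl | rfl | rfl)
    · exact DeepMLL.completeForMLL_mlsu
    all_goals exact DeepMLL.completeForMLL_mlsWith _ _ _
  exact ⟨fun 𝒮 h𝒮 𝒯 h𝒯 => (h₁ 𝒮 h𝒮).systemEquivalent (h₁ 𝒯 h𝒯),
    fun 𝒮 h𝒮 𝒯 h𝒯 => (h₂ 𝒮 h𝒮).systemEquivalent (h₂ 𝒯 h𝒯), h₂⟩
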